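/- Let $M$ be a smooth manifold of dimension $2n+s$ ($n,s>0$) with a Riemannian metric $g$ and Levi-Civita connection $\nabla$. A \emph{weak metric $f$-structure} on $(M,g)$ consists of a skew-symmetric $(1,1)$-tensor $f$ of rank $2n$, a self-adjoint nonsingular $(1,1)$-tensor $Q$, orthonormal vector fields $\xi_1,\dots,\xi_s$ and $1$-forms $\eta^1,\dots,\eta^s$ (all smooth) such that, for all vector fields $X,Y$, $$f^2=-Q+\sum_{i=1}^s\eta^i\otimes\xi_i,\qquad \eta^i(\xi_j)=\delta^i_j,\qquad Q\xi_i=\xi_i,$$ $$g(fX,fY)=g(X,QY)-\sum_{i=1}^s\eta^i(X)\,\eta^i(Y).$$ It is a \emph{nearly $\mathcal C$-structure} if moreover $Q=\mathrm{Id}$ and $(\nabla_Xf)Y+(\nabla_Yf)X=0$ for all vector fields $X,Y$. Put $\mathcal D=\bigcap_{i=1}^s\ker\eta^i$ (the contact distribution) and $R_{X,Y}=[\nabla_X,\nabla_Y]-\nabla_{[X,Y]}$. \textbf{Statement.} For every nearly $\mathcal C$-structure the contact distribution $\mathcal D$ is curvature invariant: at every point $p\in M$ and for all smooth vector fields $X,Y,Z$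 on $M$ with $X_p,Y_p,Z_p\in\mathcal D_p$, one has $(R_{X,Y}Z)_p\in\mathcal D_p$. In particular, $R_{X,Y}Z\in\mathcal D$ for all $X,Y,Z\in\mathcal D$. -/

import Mathlib

/-!
For a skew-symmetric tensor `f` with `(∇_X f) Y + (∇_Y f) X = 0`, the derivative of the 2-form
`g(f ·, ·)` is a 3-form, so `b(W; X, Y, Z) = g((∇²_{W,X} f) Y, Z)` is alternating in `X, Y, Z`. By
the Ricci identity and the pair symmetry of `R`, the result of letting `f` act on the curvature
tensor as a derivation is the alternation of `b` over all four arguments. It is therefore totally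
antisymmetric, and the first Bianchi identity forces it to vanish.

If `f ξ = 0`, then `f` also annihilates the trilinear form `g(R_{X,Y} Z, ξ)` as a derivation. Where
`f² = -1`, the derivation induced by `f` on trilinear forms has eigenvalues `±i` and `±3i`, hence is
injective, and the form vanishes.
-/

open Bundle VectorField
open scoped Manifold ContDiff

noncomputable section

namespace FManifold

section Connection

variable {E : Type*} [NormedAddCommGroup E] [NormedSpace ℝ E]
  {H : Type*} [TopologicalSpace H] {I : ModelWithCorners ℝ E H}
  {M : Type*} [TopologicalSpace M] [ChartedSpace H M] [IsManifold I ∞ M]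

/-- `X` is a smooth vector field on `M`. -/
def IsSmoothField (X : Π x : M, TangentSpace I x) : Prop :=
  ContMDiff I (I.prod 𝓘(ℝ, E)) ∞ (fun x ↦ TotalSpace.mk' E x (X x))

/-- `α` is a smooth 1-form on `M`. -/
def IsSmoothOneForm (α : Π x : M, TangentSpace I x →L[ℝ] ℝ) : Prop :=
  ContMDiff I (I.prod 𝓘(ℝ, E →L[ℝ] ℝ)) ∞
    (fun x ↦ TotalSpace.mk' (E →L[ℝ] ℝ) (E := fun x : M ↦ TangentSpace I x →L[ℝ] ℝ) x (α x))

/-- `A` is a smooth (1,1)-tensor field on `M`. -/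
def IsSmoothEndo
    (A : Π x : M, TangentSpace I x →L[ℝ] TangentSpace I x) : Prop :=
  ContMDiff I (I.prod 𝓘(ℝ, E →L[ℝ] E)) ∞
    (fun x ↦ TotalSpace.mk' (E →L[ℝ] E)
      (E := fun x : M ↦ TangentSpace I x →L[ℝ] TangentSpace I x) x (A x))

/-- The vector field `∇_X Y` (Mathlib writes the arguments of a connection in the
order `∇ Y x (X x)`). -/
def covDeriv (cov : CovariantDerivative I E (fun x : M ↦ TangentSpace I x))
    (X Y : Π x : M, TangentSpace I x) : Π x : M, TangentSpace I x :=
  fun x ↦ cov Y x (X x)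

/-- The vector field `(∇_X A) Y = ∇_X (A Y) - A (∇_X Y)` for a (1,1)-tensor field `A`. -/
def covDerivEndo (cov : CovariantDerivative I E (fun x : M ↦ TangentSpace I x))
    (A : Π x : M, TangentSpace I x →L[ℝ] TangentSpace I x)
    (X Y : Π x : M, TangentSpace I x) : Π x : M, TangentSpace I x :=
  fun x ↦ covDeriv cov X (fun y ↦ A y (Y y)) x - A x (covDeriv cov X Y x)

/-- The curvature `R_{X,Y} Z = ∇_X ∇_Y Z - ∇_Y ∇_X Z - ∇_{[X,Y]} Z`. -/
def curvature (cov : CovariantDerivative I E (fun x : M ↦ TangentSpace I x))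
    (X Y Z : Π x : M, TangentSpace I x) : Π x : M, TangentSpace I x :=
  fun x ↦ covDeriv cov X (covDeriv cov Y Z) x - covDeriv cov Y (covDeriv cov X Z) x
    - covDeriv cov (mlieBracket I X Y) Z x

/-- `cov` is the Levi-Civita connection of the Riemannian metric of `M`: a smooth affine
connection with `X g(Y, Z) = g(∇_X Y, Z) + g(Y, ∇_X Z)` and `∇_X Y - ∇_Y X = [X, Y]`. -/
structure IsLeviCivita [RiemannianBundle (fun x : M ↦ TangentSpace I x)]
    (cov : CovariantDerivative I E (fun x : M ↦ TangentSpace I x)) : Prop where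
  smooth : cov.ContMDiffCovariantDerivative ∞
  metric : ∀ X Y Z : Π x : M, TangentSpace I x,
    IsSmoothField X → IsSmoothField Y → IsSmoothField Z → ∀ x : M,
      mvfderiv I (fun y ↦ (inner ℝ (Y y) (Z y) : ℝ)) x (X x) =
        inner ℝ (covDeriv cov X Y x) (Z x) + inner ℝ (Y x) (covDeriv cov X Z x)
  torsion_free : ∀ X Y : Π x : M, TangentSpace I x,
    IsSmoothField X → IsSmoothField Y → ∀ x : M,
      covDeriv cov X Y x - covDeriv cov Y X x = mlieBracket I X Y x

end Connection

section Structures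

variable {E : Type*} [NormedAddCommGroup E] [NormedSpace ℝ E] [FiniteDimensional ℝ E]
  {H : Type*} [TopologicalSpace H] (I : ModelWithCorners ℝ E H)
  (M : Type*) [TopologicalSpace M] [ChartedSpace H M] [IsManifold I ∞ M]
  [RiemannianBundle (fun x : M ↦ TangentSpace I x)]

/-- A weak metric `f`-structure `(f, Q, ξ, η, g)` on a manifold of dimension `2 n + s`, where `g`
is the ambient Riemannian metric of `M`. -/
structure WeakMetricFStructure (n s : ℕ) where
  f : Π x : M, TangentSpace I x →L[ℝ] TangentSpace I x
  Q : Π x : M, TangentSpace I x →L[ℝ] TangentSpace I x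
  ξ : Fin s → Π x : M, TangentSpace I x
  η : Fin s → Π x : M, TangentSpace I x →L[ℝ] ℝ
  n_pos : 0 < n
  s_pos : 0 < s
  dim_eq : Module.finrank ℝ E = 2 * n + s
  f_smooth : IsSmoothEndo f
  Q_smooth : IsSmoothEndo Q
  ξ_smooth : ∀ i, IsSmoothField (ξ i)
  η_smooth : ∀ i, IsSmoothOneForm (η i)
  f_skew : ∀ (x : M) (v w : TangentSpace I x), inner ℝ (f x v) w = - inner ℝ v (f x w)
  f_rank : ∀ x : M, Module.finrank ℝ (LinearMap.range (f x).toLinearMap) = 2 * n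
  Q_selfAdjoint : ∀ (x : M) (v w : TangentSpace I x), inner ℝ (Q x v) w = inner ℝ v (Q x w)
  Q_nonsingular : ∀ x : M, Function.Bijective (Q x)
  ξ_orthonormal : ∀ x : M, Orthonormal ℝ (fun i ↦ ξ i x)
  η_ξ : ∀ (x : M) (i j : Fin s), η i x (ξ j x) = if i = j then 1 else 0
  Q_ξ : ∀ (x : M) (i : Fin s), Q x (ξ i x) = ξ i x
  f_sq : ∀ (x : M) (v : TangentSpace I x),
    f x (f x v) = - Q x v + ∑ i, η i x v • ξ i x
  inner_f_f : ∀ (x : M) (v w : TangentSpace I x),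
    inner ℝ (f x v) (f x w) = inner ℝ v (Q x w) - ∑ i, η i x v * η i x w

namespace WeakMetricFStructure

variable {I M} {n s : ℕ}

/-- The contact distribution `D = ⋂ i, ker (η i)`. -/
def contactDistribution (S : WeakMetricFStructure I M n s) (x : M) :
    Submodule ℝ (TangentSpace I x) :=
  ⨅ i, LinearMap.ker (S.η i x).toLinearMap

/-- The structure is weak nearly `C` with respect to the connection `cov`, which is meant to be
the Levi-Civita connection: `(∇_X f) Y + (∇_Y f) X = 0`. -/
def IsWeakNearlyC (S : WeakMetricFStructure I M n s)
    (cov : CovariantDerivative I E (fun x : M ↦ TangentSpace I x)) : Prop :=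
  ∀ X Y : Π x : M, TangentSpace I x, IsSmoothField X → IsSmoothField Y →
    ∀ x : M, covDerivEndo cov S.f X Y x + covDerivEndo cov S.f Y X x = 0

/-- A nearly `C`-structure is a weak nearly `C`-structure with `Q = id`. -/
def IsNearlyC (S : WeakMetricFStructure I M n s)
    (cov : CovariantDerivative I E (fun x : M ↦ TangentSpace I x)) : Prop :=
  S.IsWeakNearlyC cov ∧ ∀ x : M, S.Q x = ContinuousLinearMap.id ℝ (TangentSpace I x)

end WeakMetricFStructure

end Structures

end FManifold

end

namespace FManifold

section Algebra

variable {V 𝕜 : Type*} [Field 𝕜]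

/-- The symmetries of the Riemann curvature tensor: skew-symmetry in the first two and in the last
two arguments, and the first Bianchi identity. Multilinearity is not part of the definition, so
that `V` can be a mere type of vector fields. -/
structure IsAlgebraicCurvature (R : V → V → V → V → 𝕜) : Prop where
  swap_left : ∀ x y z w, R x y z w = -R y x z w
  swap_right : ∀ x y z w, R x y z w = -R x y w z
  bianchi : ∀ x y z w, R x y z w + R y z x w + R z x y w = 0

/-- The action of `J` as a derivation on a form `R` of four arguments, without the usual minus
sign. -/
def derivAction (J : V → V) (R : V → V → V → V → 𝕜) (x y z w : V) : 𝕜 :=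
  R (J x) y z w + R x (J y) z w + R x y (J z) w + R x y z (J w)

variable [CharZero 𝕜]

theorem IsAlgebraicCurvature.pair_swap {R : V → V → V → V → 𝕜} (hR : IsAlgebraicCurvature R)
    (x y z w : V) : R x y z w = R z w x y := by
  have l := hR.swap_left
  have r := hR.swap_right
  linear_combination
    (hR.bianchi x y z w + hR.bianchi y z w x - hR.bianchi z w x y - hR.bianchi w x y z
      - (r y z w x + r z w y x + l w y z x)
      + (l w x z y - r x w z y + l x z w y - r z x w y)
      + (l w x y z + r x y w z + r y w x z)) / 2

/-- The form `b` plays the role of `g((∇²_{w,x} f) y, z)`, and `ricci` that of the Ricci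
identity. -/
theorem IsAlgebraicCurvature.derivAction_eq_zero {R : V → V → V → V → 𝕜}
    (hR : IsAlgebraicCurvature R) (J : V → V) (b : V → V → V → V → 𝕜)
    (b_swap₂₃ : ∀ w x y z, b w x y z = -b w y x z)
    (b_swap₃₄ : ∀ w x y z, b w x y z = -b w x z y)
    (ricci : ∀ w x y z, b w x y z - b x w y z = R w x (J y) z + R w x y (J z)) (w x y z : V) :
    derivAction J R w x y z = 0 := by
  have b_cycle (w x y z : V) : b w x y z = b w y z x := by
    rw [b_swap₂₃, b_swap₃₄, neg_neg]
  have alternation (w x y z : V) :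
      derivAction J R w x y z = b w x y z - b x w y z + b y w x z - b z w x y := by
    simp only [derivAction]
    linear_combination hR.pair_swap (J w) x y z + hR.pair_swap w (J x) y z - ricci w x y z
      - ricci y z w x + b_cycle y z w x - b_cycle z y w x
  have cycle (w x y z : V) : derivAction J R x y w z = derivAction J R w x y z := by
    linear_combination alternation x y w z - alternation w x y z + b_swap₂₃ x y w z
      - b_swap₂₃ y x w z + b_cycle z w x y
  have bianchi :
      derivAction J R w x y z + derivAction J R x y w z + derivAction J R y w x z = 0 := by
    simp only [derivAction]
    linear_combination hR.bianchi (J w) x y z + hR.bianchi w (J x) y z + hR.bianchi w x (J y) z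
      + hR.bianchi w x y (J z)
  linear_combination (bianchi - 2 * cycle w x y z - cycle x y w z) / 3

theorem eq_zero_of_derivation_eq_zero_of_sq_eq_neg (J : V → V) (r : V → V → V → 𝕜)
    (sq₁ : ∀ x y z, r (J (J x)) y z = -r x y z) (sq₂ : ∀ x y z, r x (J (J y)) z = -r x y z)
    (sq₃ : ∀ x y z, r x y (J (J z)) = -r x y z)
    (derivation : ∀ x y z, r (J x) y z + r x (J y) z + r x y (J z) = 0) (x y z : V) :
    r x y z = 0 := by
  have left := derivation (J x) y z
  have middle := derivation x (J y) z
  have right := derivation x y (J z)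
  have thrice := derivation (J x) (J y) (J z)
  simp only [sq₁, sq₂, sq₃] at left middle right thrice
  linear_combination -(left + middle + right + 2 * thrice) / 3

end Algebra

section SmoothFields

variable {E : Type*} [NormedAddCommGroup E] [NormedSpace ℝ E]
  {H : Type*} [TopologicalSpace H] {I : ModelWithCorners ℝ E H}
  {M : Type*} [TopologicalSpace M] [ChartedSpace H M] [IsManifold I ∞ M]
  {X Y Z : Π x : M, TangentSpace I x} {u : M → ℝ}

namespace IsSmoothField

theorem mdifferentiableAt (hX : IsSmoothField X) (x : M) : MDiffAt (T% X) x :=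
  ContMDiff.mdifferentiableAt hX (by simp)

theorem sub (hX : IsSmoothField X) (hY : IsSmoothField Y) : IsSmoothField (X - Y) :=
  ContMDiff.sub_section hX hY

theorem smul (hu : CMDiff ∞ u) (hX : IsSmoothField X) : IsSmoothField (u • X) :=
  ContMDiff.smul_section hu hX

theorem endo_apply {A : Π x : M, TangentSpace I x →L[ℝ] TangentSpace I x}
    (hA : IsSmoothEndo A) (hX : IsSmoothField X) : IsSmoothField (fun x ↦ A x (X x)) :=
  ContMDiff.clm_bundle_apply (F₁ := E) (F₂ := E) hA hX

theorem contMDiff_mvfderiv (hX : IsSmoothField X) (hu : CMDiff ∞ u) :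
    CMDiff ∞ (fun x ↦ mvfderiv I u x (X x)) :=
  (contMDiff_snd_tangentBundle_modelSpace ℝ 𝓘(ℝ, ℝ)).comp
    ((hu.contMDiff_tangentMap (m := ∞) (by simp)).comp hX)

theorem contMDiff_inner [RiemannianBundle (fun x : M ↦ TangentSpace I x)]
    [IsContMDiffRiemannianBundle I ∞ E (fun x : M ↦ TangentSpace I x)]
    (hX : IsSmoothField X) (hY : IsSmoothField Y) :
    CMDiff ∞ (fun x ↦ (inner ℝ (X x) (Y x) : ℝ)) :=
  ContMDiff.inner_bundle hX hY

variable [CompleteSpace E]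

theorem mlieBracket (hX : IsSmoothField X) (hY : IsSmoothField Y) :
    IsSmoothField (mlieBracket I X Y) := by
  have : IsManifold I (minSmoothness ℝ 2) M := by
    rw [minSmoothness_of_isRCLikeNormedField]; infer_instance
  have : IsManifold I ((⊤ : ℕ∞) + 1) M := inferInstanceAs (IsManifold I ∞ M)
  exact ContDiff.mlieBracket_vectorField (m := ⊤) (n := ⊤) hX hY (by simp)

theorem mlieBracket_jacobi (hX : IsSmoothField X) (hY : IsSmoothField Y) (hZ : IsSmoothField Z)
    (x : M) :
    VectorField.mlieBracket I X (VectorField.mlieBracket I Y Z) x =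
      VectorField.mlieBracket I (VectorField.mlieBracket I X Y) Z x
        + VectorField.mlieBracket I Y (VectorField.mlieBracket I X Z) x := by
  have : IsManifold I (minSmoothness ℝ 3) M := by
    rw [minSmoothness_of_isRCLikeNormedField]; infer_instance
  apply leibniz_identity_mlieBracket_apply <;> rw [minSmoothness_of_isRCLikeNormedField]
  all_goals refine ContMDiffAt.of_le (n := ∞) ?_ (WithTop.coe_le_coe.2 (le_top : (2 : ℕ∞) ≤ ⊤))
  exacts [hX x, hY x, hZ x]

theorem mlieBracket_mlieBracket_smul (hY : IsSmoothField Y) (hZ : IsSmoothField Z)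
    (hu : CMDiff ∞ u) (x : M) :
    VectorField.mlieBracket I X (VectorField.mlieBracket I Y (u • Z)) x =
      mvfderiv I (fun y ↦ mvfderiv I u y (Y y)) x (X x) • Z x
        + mvfderiv I u x (Y x) • VectorField.mlieBracket I X Z x
        + mvfderiv I u x (X x) • VectorField.mlieBracket I Y Z x
        + u x • VectorField.mlieBracket I X (VectorField.mlieBracket I Y Z) x := by
  have leibniz : VectorField.mlieBracket I Y (u • Z) =
      (fun y ↦ mvfderiv I u y (Y y)) • Z + u • VectorField.mlieBracket I Y Z :=
    funext fun y ↦ mlieBracket_smul_right (hu.mdifferentiableAt (by simp)) (hZ.mdifferentiableAt y)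
  have hYu := hY.contMDiff_mvfderiv hu
  have hYZ := hY.mlieBracket hZ
  rw [leibniz, mlieBracket_add_right ((hZ.smul hYu).mdifferentiableAt x)
      ((hYZ.smul hu).mdifferentiableAt x),
    mlieBracket_smul_right (hYu.mdifferentiableAt (by simp)) (hZ.mdifferentiableAt x),
    mlieBracket_smul_right (hu.mdifferentiableAt (by simp)) (hYZ.mdifferentiableAt x)]
  module

/-- Comparing both sides of the Jacobi identity for `X, Y, u • Z` gives this equation multiplied by
`Z x`; if neither `X` nor `Y` can serve as `Z`, then both sides vanish. -/
theorem mvfderiv_mlieBracket (hX : IsSmoothField X) (hY : IsSmoothField Y) (hu : CMDiff ∞ u)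
    (x : M) :
    mvfderiv I u x (VectorField.mlieBracket I X Y x) =
      mvfderiv I (fun y ↦ mvfderiv I u y (Y y)) x (X x)
        - mvfderiv I (fun y ↦ mvfderiv I u y (X y)) x (Y x) := by
  have of_ne_zero {Z : Π x : M, TangentSpace I x} (hZ : IsSmoothField Z) (hx : Z x ≠ 0) :
      mvfderiv I u x (VectorField.mlieBracket I X Y x) =
        mvfderiv I (fun y ↦ mvfderiv I u y (Y y)) x (X x)
          - mvfderiv I (fun y ↦ mvfderiv I u y (X y)) x (Y x) := by
    have jacobi := mlieBracket_jacobi hX hY (hZ.smul hu) x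
    rw [mlieBracket_mlieBracket_smul hY hZ hu, mlieBracket_mlieBracket_smul hX hZ hu,
      mlieBracket_smul_right (hu.mdifferentiableAt (by simp)) (hZ.mdifferentiableAt x),
      mlieBracket_jacobi hX hY hZ] at jacobi
    refine smul_left_injective ℝ hx ?_
    linear_combination (norm := module) -jacobi
  by_cases hXx : X x = 0
  · by_cases hYx : Y x = 0
    · rw [← mlieBracketWithin_univ, mlieBracketWithin_eq_zero_of_eq_zero hXx hYx, hXx, hYx]
      simp only [map_zero, sub_zero]
    · exact of_ne_zero hY hYx
  · exact of_ne_zero hX hXx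

end IsSmoothField

end SmoothFields

section Connection

variable {E : Type*} [NormedAddCommGroup E] [NormedSpace ℝ E]
  {H : Type*} [TopologicalSpace H] {I : ModelWithCorners ℝ E H}
  {M : Type*} [TopologicalSpace M] [ChartedSpace H M] [IsManifold I ∞ M]
  {cov : CovariantDerivative I E (fun x : M ↦ TangentSpace I x)}
  {A : Π x : M, TangentSpace I x →L[ℝ] TangentSpace I x}
  {W X X' Y Y' Z Z' : Π x : M, TangentSpace I x} {u : M → ℝ}

theorem covDeriv_add_left : covDeriv cov (X + X') Y = covDeriv cov X Y + covDeriv cov X' Y :=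
  funext fun x ↦ (cov Y x).map_add (X x) (X' x)

theorem covDeriv_sub_left : covDeriv cov (X - X') Y = covDeriv cov X Y - covDeriv cov X' Y :=
  funext fun x ↦ (cov Y x).map_sub (X x) (X' x)

theorem covDeriv_neg_left : covDeriv cov (-X) Y = -covDeriv cov X Y :=
  funext fun x ↦ (cov Y x).map_neg (X x)

theorem covDeriv_smul_left : covDeriv cov (u • X) Y = u • covDeriv cov X Y :=
  funext fun x ↦ (cov Y x).map_smul (u x) (X x)

theorem covDeriv_add_right {x : M} (hY : MDiffAt (T% Y) x) (hZ : MDiffAt (T% Z) x) :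
    covDeriv cov X (Y + Z) x = covDeriv cov X Y x + covDeriv cov X Z x :=
  congr($(cov.isCovariantDerivativeOnUniv.add hY hZ) (X x))

theorem covDeriv_smul_right {x : M} (hu : MDiffAt u x) (hY : MDiffAt (T% Y) x) :
    covDeriv cov X (u • Y) x = u x • covDeriv cov X Y x + mvfderiv I u x (X x) • Y x :=
  congr($(cov.isCovariantDerivativeOnUniv.leibniz hY hu) (X x))

theorem covDeriv_neg_right {x : M} (hY : MDiffAt (T% Y) x) :
    covDeriv cov X (-Y) x = -covDeriv cov X Y x := by
  have h := covDeriv_smul_right (cov := cov) (X := X) (u := fun _ ↦ -1) mdifferentiableAt_const hY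
  have neg_eq : (fun _ : M ↦ (-1 : ℝ)) • Y = -Y := funext fun y ↦ neg_one_smul ℝ (Y y)
  simpa [neg_eq, mvfderiv_const] using h

theorem covDeriv_sub_right {x : M} (hY : MDiffAt (T% Y) x) (hZ : MDiffAt (T% Z) x) :
    covDeriv cov X (Y - Z) x = covDeriv cov X Y x - covDeriv cov X Z x := by
  rw [sub_eq_add_neg, covDeriv_add_right hY (mdifferentiableAt_neg_section hZ),
    covDeriv_neg_right hZ, sub_eq_add_neg]

theorem curvature_swap (x : M) : curvature cov X Y Z x = -curvature cov Y X Z x := by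
  simp only [curvature]
  rw [mlieBracket_swap, covDeriv_neg_left, Pi.neg_apply]
  abel

variable (cov A) in
/-- The second covariant derivative `(∇²_{W, X} A) Y` of a (1,1)-tensor field `A`. -/
noncomputable def secondCovDerivEndo (W X Y : Π x : M, TangentSpace I x) :
    Π x : M, TangentSpace I x :=
  fun x ↦ covDeriv cov W (covDerivEndo cov A X Y) x
    - covDerivEndo cov A (covDeriv cov W X) Y x - covDerivEndo cov A X (covDeriv cov W Y) x

variable (cov) in
/-- The connection `cov` has no torsion, tested on smooth vector fields as in `IsLeviCivita`. -/
def IsTorsionFree : Prop :=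
  ∀ X Y : Π x : M, TangentSpace I x, IsSmoothField X → IsSmoothField Y →
    ∀ x : M, covDeriv cov X Y x - covDeriv cov Y X x = mlieBracket I X Y x

variable (cov A) in
/-- The (1,1)-tensor field `A` is nearly parallel: `(∇_X A) Y + (∇_Y A) X = 0`. For a
skew-symmetric `A` this says that the 2-form `g(A ·, ·)` is a Killing form. -/
def IsNearlyParallel : Prop :=
  ∀ X Y : Π x : M, TangentSpace I x, IsSmoothField X → IsSmoothField Y →
    ∀ x : M, covDerivEndo cov A X Y x + covDerivEndo cov A Y X x = 0

section SmoothConnection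

variable [cov.ContMDiffCovariantDerivative ∞]

theorem IsSmoothField.contMDiff_cov (hY : IsSmoothField Y) : IsSmoothEndo (cov Y) :=
  have smooth := CovariantDerivative.ContMDiffCovariantDerivative.contMDiff (cov := cov) (k := ∞)
  contMDiffOn_univ.1 (smooth.contMDiff (ContMDiff.contMDiffOn hY))

theorem IsSmoothField.covDeriv (hX : IsSmoothField X) (hY : IsSmoothField Y) :
    IsSmoothField (covDeriv cov X Y) :=
  hX.endo_apply hY.contMDiff_cov

theorem IsSmoothField.covDerivEndo (hA : IsSmoothEndo A) (hX : IsSmoothField X)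
    (hY : IsSmoothField Y) : IsSmoothField (covDerivEndo cov A X Y) :=
  (hX.covDeriv (hY.endo_apply hA)).sub ((hX.covDeriv hY).endo_apply hA)

theorem IsNearlyParallel.secondCovDerivEndo_swap (hA : IsNearlyParallel cov A)
    (hA_smooth : IsSmoothEndo A) (hW : IsSmoothField W) (hX : IsSmoothField X)
    (hY : IsSmoothField Y) (x : M) :
    secondCovDerivEndo cov A W X Y x = -secondCovDerivEndo cov A W Y X x := by
  have swap {X Y : Π x : M, TangentSpace I x} (hX : IsSmoothField X) (hY : IsSmoothField Y) :
      covDerivEndo cov A X Y = -covDerivEndo cov A Y X :=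
    funext fun y ↦ eq_neg_of_add_eq_zero_left (hA X Y hX hY y)
  simp only [secondCovDerivEndo]
  rw [swap hX hY, covDeriv_neg_right ((hY.covDerivEndo hA_smooth hX).mdifferentiableAt x),
    swap (hW.covDeriv hX) hY, swap hX (hW.covDeriv hY)]
  simp only [Pi.neg_apply]
  abel

namespace IsTorsionFree

theorem secondCovDerivEndo_sub_swap (hcov : IsTorsionFree cov) (hA : IsSmoothEndo A)
    (hW : IsSmoothField W) (hX : IsSmoothField X) (hY : IsSmoothField Y) (x : M) :
    secondCovDerivEndo cov A W X Y x - secondCovDerivEndo cov A X W Y x =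
      curvature cov W X (fun y ↦ A y (Y y)) x - A x (curvature cov W X Y x) := by
  have covDeriv_covDerivEndo {V U : Π x : M, TangentSpace I x} (hU : IsSmoothField U) :
      covDeriv cov V (covDerivEndo cov A U Y) x =
        covDeriv cov V (covDeriv cov U (fun y ↦ A y (Y y))) x
          - covDeriv cov V (fun y ↦ A y (covDeriv cov U Y y)) x :=
    covDeriv_sub_right ((hU.covDeriv (hY.endo_apply hA)).mdifferentiableAt x)
      (((hU.covDeriv hY).endo_apply hA).mdifferentiableAt x)
  have bracket : mlieBracket I W X = covDeriv cov W X - covDeriv cov X W :=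
    funext fun y ↦ (hcov W X hW hX y).symm
  simp only [secondCovDerivEndo, curvature, bracket, covDeriv_sub_left,
    covDeriv_covDerivEndo hX, covDeriv_covDerivEndo hW]
  simp only [covDerivEndo, Pi.sub_apply, map_sub]
  abel

theorem covDeriv_covDeriv_sub [CompleteSpace E] (hcov : IsTorsionFree cov) (hX : IsSmoothField X)
    (hY : IsSmoothField Y) (hZ : IsSmoothField Z) (x : M) :
    covDeriv cov X (covDeriv cov Y Z) x - covDeriv cov X (covDeriv cov Z Y) x =
      mlieBracket I X (mlieBracket I Y Z) x + covDeriv cov (mlieBracket I Y Z) X x := by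
  have bracket : covDeriv cov Y Z - covDeriv cov Z Y = mlieBracket I Y Z :=
    funext fun y ↦ hcov Y Z hY hZ y
  rw [← covDeriv_sub_right ((hY.covDeriv hZ).mdifferentiableAt x)
      ((hZ.covDeriv hY).mdifferentiableAt x), bracket,
    ← hcov _ _ hX (hY.mlieBracket hZ), sub_add_cancel]

theorem curvature_bianchi [CompleteSpace E] (hcov : IsTorsionFree cov) (hX : IsSmoothField X)
    (hY : IsSmoothField Y) (hZ : IsSmoothField Z) (x : M) :
    curvature cov X Y Z x + curvature cov Y Z X x + curvature cov Z X Y x = 0 := by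
  have jacobi := hX.mlieBracket_jacobi hY hZ x
  rw [mlieBracket_swap_apply (V := mlieBracket I X Y)] at jacobi
  simp only [curvature]
  rw [mlieBracket_swap (V := Z) (W := X), covDeriv_neg_left, Pi.neg_apply]
  linear_combination (norm := module) hcov.covDeriv_covDeriv_sub hX hY hZ x
    - hcov.covDeriv_covDeriv_sub hY hX hZ x + hcov.covDeriv_covDeriv_sub hZ hX hY x + jacobi

end IsTorsionFree

theorem curvature_tensorialAt [CompleteSpace E] (hZ : IsSmoothField Z) (x : M) :
    TensorialAt I E (fun X ↦ curvature cov X Y Z x) x where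
  smul {u V} hu hV := by
    have hVZ : MDiffAt (T% (covDeriv cov V Z)) x :=
      MDifferentiableAt.clm_bundle_apply (F₁ := E) (F₂ := E)
        (hZ.contMDiff_cov.mdifferentiableAt (by simp)) hV
    simp only [curvature]
    rw [covDeriv_smul_left (Y := Z), covDeriv_smul_right hu hVZ]
    simp only [covDeriv, mlieBracket_smul_left hu hV, Pi.smul_apply', map_add, map_smul]
    module
  add {V V'} hV hV' := by
    have hcovZ {U : Π x : M, TangentSpace I x} (hU : MDiffAt (T% U) x) :
        MDiffAt (T% (covDeriv cov U Z)) x :=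
      MDifferentiableAt.clm_bundle_apply (F₁ := E) (F₂ := E)
        (hZ.contMDiff_cov.mdifferentiableAt (by simp)) hU
    simp only [curvature]
    rw [covDeriv_add_left (Y := Z), covDeriv_add_right (hcovZ hV) (hcovZ hV')]
    simp only [covDeriv, mlieBracket_add_left hV hV', Pi.add_apply, map_add]
    abel

section Pointwise

variable [FiniteDimensional ℝ E] {x : M}

theorem curvature_eq_neg_of_left_eq_neg (hX : IsSmoothField X) (hX' : IsSmoothField X')
    (hZ : IsSmoothField Z) (h : X' x = -X x) :
    curvature cov X' Y Z x = -curvature cov X Y Z x := by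
  have := FiniteDimensional.complete ℝ E
  have tensorial := curvature_tensorialAt (cov := cov) (Y := Y) hZ x
  rw [← tensorial.mkHom_apply (hX'.mdifferentiableAt x), h, map_neg,
    tensorial.mkHom_apply (hX.mdifferentiableAt x)]

theorem curvature_eq_neg_of_middle_eq_neg (hY : IsSmoothField Y) (hY' : IsSmoothField Y')
    (hZ : IsSmoothField Z) (h : Y' x = -Y x) :
    curvature cov X Y' Z x = -curvature cov X Y Z x := by
  rw [curvature_swap, curvature_eq_neg_of_left_eq_neg hY hY' hZ h, ← curvature_swap]

theorem IsTorsionFree.curvature_eq_neg_of_right_eq_neg (hcov : IsTorsionFree cov)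
    (hX : IsSmoothField X) (hY : IsSmoothField Y) (hZ : IsSmoothField Z) (hZ' : IsSmoothField Z')
    (h : Z' x = -Z x) : curvature cov X Y Z' x = -curvature cov X Y Z x := by
  have := FiniteDimensional.complete ℝ E
  linear_combination (norm := module) hcov.curvature_bianchi hX hY hZ' x
    + hcov.curvature_bianchi hX hY hZ x
    - curvature_eq_neg_of_middle_eq_neg (cov := cov) (X := Y) hZ hZ' hX h
    - curvature_eq_neg_of_left_eq_neg (cov := cov) (Y := X) hZ hZ' hY h

end Pointwise

end SmoothConnection

end Connection

section Metric

variable {E : Type*} [NormedAddCommGroup E] [NormedSpace ℝ E]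
  {H : Type*} [TopologicalSpace H] {I : ModelWithCorners ℝ E H}
  {M : Type*} [TopologicalSpace M] [ChartedSpace H M] [IsManifold I ∞ M]
  [RiemannianBundle (fun x : M ↦ TangentSpace I x)]
  {cov : CovariantDerivative I E (fun x : M ↦ TangentSpace I x)}
  {A : Π x : M, TangentSpace I x →L[ℝ] TangentSpace I x}
  {W X Y Z : Π x : M, TangentSpace I x}

variable (cov) in
/-- The connection `cov` preserves the metric, tested on smooth vector fields as in
`IsLeviCivita`. -/
def IsMetric : Prop :=
  ∀ X Y Z : Π x : M, TangentSpace I x,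
    IsSmoothField X → IsSmoothField Y → IsSmoothField Z → ∀ x : M,
      mvfderiv I (fun y ↦ (inner ℝ (Y y) (Z y) : ℝ)) x (X x) =
        inner ℝ (covDeriv cov X Y x) (Z x) + inner ℝ (Y x) (covDeriv cov X Z x)

variable (A) in
/-- The (1,1)-tensor field `A` is skew-symmetric with respect to the metric. -/
def IsSkewSymmetric : Prop :=
  ∀ (x : M) (v w : TangentSpace I x), inner ℝ (A x v) w = -inner ℝ v (A x w)

namespace IsSkewSymmetric

theorem inner_covDerivEndo (hA : IsSkewSymmetric A) (hcov : IsMetric cov)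
    (hA_smooth : IsSmoothEndo A) (hX : IsSmoothField X) (hY : IsSmoothField Y)
    (hZ : IsSmoothField Z) (x : M) :
    inner ℝ (covDerivEndo cov A X Y x) (Z x) = -inner ℝ (Y x) (covDerivEndo cov A X Z x) := by
  have deriv_left := hcov X _ _ hX (hY.endo_apply hA_smooth) hZ x
  have deriv_right := hcov X _ _ hX hY (hZ.endo_apply hA_smooth) x
  simp only [hA _ _ (Z _), mvfderiv_fun_neg, neg_apply] at deriv_left
  simp only [covDerivEndo, inner_sub_left, inner_sub_right]
  linear_combination -deriv_left - deriv_right - hA x (covDeriv cov X Y x) (Z x)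
    - hA x (Y x) (covDeriv cov X Z x)

variable [cov.ContMDiffCovariantDerivative ∞]

theorem inner_secondCovDerivEndo (hA : IsSkewSymmetric A) (hcov : IsMetric cov)
    (hA_smooth : IsSmoothEndo A) (hW : IsSmoothField W) (hX : IsSmoothField X)
    (hY : IsSmoothField Y) (hZ : IsSmoothField Z) (x : M) :
    inner ℝ (secondCovDerivEndo cov A W X Y x) (Z x) =
      -inner ℝ (Y x) (secondCovDerivEndo cov A W X Z x) := by
  have deriv_left := hcov W _ _ hW (hX.covDerivEndo (cov := cov) hA_smooth hY) hZ x
  have deriv_right := hcov W _ _ hW hY (hX.covDerivEndo (cov := cov) hA_smooth hZ) x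
  simp only [hA.inner_covDerivEndo hcov hA_smooth hX hY hZ, mvfderiv_fun_neg, neg_apply]
    at deriv_left
  simp only [secondCovDerivEndo, inner_sub_left, inner_sub_right]
  linear_combination -deriv_left - deriv_right
    - hA.inner_covDerivEndo hcov hA_smooth (hW.covDeriv (cov := cov) hX) hY hZ x
    - hA.inner_covDerivEndo hcov hA_smooth hX (hW.covDeriv (cov := cov) hY) hZ x
    - hA.inner_covDerivEndo hcov hA_smooth hX hY (hW.covDeriv (cov := cov) hZ) x

end IsSkewSymmetric

namespace IsMetric

variable [cov.ContMDiffCovariantDerivative ∞]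
  [IsContMDiffRiemannianBundle I ∞ E (fun x : M ↦ TangentSpace I x)]

theorem mvfderiv_mvfderiv_inner (hcov : IsMetric cov) (hX : IsSmoothField X)
    (hY : IsSmoothField Y) (hZ : IsSmoothField Z) (hW : IsSmoothField W) (x : M) :
    mvfderiv I (fun y ↦ mvfderiv I (fun y ↦ (inner ℝ (Z y) (W y) : ℝ)) y (Y y)) x (X x) =
      inner ℝ (covDeriv cov X (covDeriv cov Y Z) x) (W x)
        + inner ℝ (covDeriv cov Y Z x) (covDeriv cov X W x)
        + (inner ℝ (covDeriv cov X Z x) (covDeriv cov Y W x)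
          + inner ℝ (Z x) (covDeriv cov X (covDeriv cov Y W) x)) := by
  have hYZ := hY.covDeriv (cov := cov) hZ
  have hYW := hY.covDeriv (cov := cov) hW
  simp only [hcov Y Z W hY hZ hW]
  rw [mvfderiv_fun_add ((hYZ.contMDiff_inner hW).mdifferentiableAt (by simp))
    ((hZ.contMDiff_inner hYW).mdifferentiableAt (by simp)), add_apply, hcov X _ _ hX hYZ hW,
    hcov X _ _ hX hZ hYW]

theorem inner_curvature_swap [CompleteSpace E] (hcov : IsMetric cov) (hX : IsSmoothField X)
    (hY : IsSmoothField Y) (hZ : IsSmoothField Z) (hW : IsSmoothField W) (x : M) :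
    inner ℝ (curvature cov X Y Z x) (W x) = -inner ℝ (curvature cov X Y W x) (Z x) := by
  have commutator := hX.mvfderiv_mlieBracket hY (hZ.contMDiff_inner hW) x
  rw [hcov.mvfderiv_mvfderiv_inner hX hY hZ hW, hcov.mvfderiv_mvfderiv_inner hY hX hZ hW,
    hcov _ _ _ (hX.mlieBracket hY) hZ hW] at commutator
  rw [real_inner_comm (Z x)]
  simp only [curvature, inner_sub_left, inner_sub_right]
  linear_combination -commutator

end IsMetric

variable (I M) in
/-- The smooth vector fields on `M`, as the type of arguments of the curvature tensor. -/
abbrev SmoothField : Type _ :=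
  {X : Π x : M, TangentSpace I x // IsSmoothField X}

/-- The smooth vector field `A X`. -/
noncomputable def SmoothField.map (hA : IsSmoothEndo A) (X : SmoothField I M) : SmoothField I M :=
  ⟨fun x ↦ A x (X.1 x), X.2.endo_apply hA⟩

variable (cov) in
/-- The value `g(R_{X,Y} Z, W)` at `p` of the curvature tensor with four arguments, as a function of
smooth vector fields. -/
noncomputable def curvatureForm (p : M) (X Y Z W : SmoothField I M) : ℝ :=
  inner ℝ (curvature cov X.1 Y.1 Z.1 p) (W.1 p)

variable [IsContMDiffRiemannianBundle I ∞ E (fun x : M ↦ TangentSpace I x)] [CompleteSpace E]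

theorem IsLeviCivita.isAlgebraicCurvature (hcov : IsLeviCivita cov) (p : M) :
    IsAlgebraicCurvature (curvatureForm cov p) where
  swap_left X Y Z W := by
    rw [curvatureForm, curvature_swap, inner_neg_left, curvatureForm]
  swap_right X Y Z W :=
    have := hcov.smooth
    IsMetric.inner_curvature_swap hcov.metric X.2 Y.2 Z.2 W.2 p
  bianchi X Y Z W := by
    have := hcov.smooth
    have torsionFree : IsTorsionFree cov := hcov.torsion_free
    simp only [curvatureForm]
    rw [← inner_add_left, ← inner_add_left, torsionFree.curvature_bianchi X.2 Y.2 Z.2,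
      inner_zero_left]

theorem IsNearlyParallel.derivAction_curvatureForm_eq_zero (hcov : IsLeviCivita cov)
    (hA : IsNearlyParallel cov A) (hA_smooth : IsSmoothEndo A) (hA_skew : IsSkewSymmetric A) (p : M)
    (W X Y Z : SmoothField I M) :
    derivAction (SmoothField.map hA_smooth) (curvatureForm cov p) W X Y Z = 0 := by
  have := hcov.smooth
  have torsionFree : IsTorsionFree cov := hcov.torsion_free
  refine (hcov.isAlgebraicCurvature p).derivAction_eq_zero _
    (fun W X Y Z ↦ inner ℝ (secondCovDerivEndo cov A W.1 X.1 Y.1 p) (Z.1 p))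
    (fun W X Y Z ↦ ?_) (fun W X Y Z ↦ ?_) (fun W X Y Z ↦ ?_) W X Y Z
  · rw [hA.secondCovDerivEndo_swap hA_smooth W.2 X.2 Y.2, inner_neg_left]
  · rw [hA_skew.inner_secondCovDerivEndo hcov.metric hA_smooth W.2 X.2 Y.2 Z.2, real_inner_comm]
  · rw [← inner_sub_left, torsionFree.secondCovDerivEndo_sub_swap hA_smooth W.2 X.2 Y.2,
      inner_sub_left, hA_skew, sub_neg_eq_add]
    rfl

end Metric

namespace WeakMetricFStructure

variable {E : Type*} [NormedAddCommGroup E] [NormedSpace ℝ E]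
  {H : Type*} [TopologicalSpace H] {I : ModelWithCorners ℝ E H}
  {M : Type*} [TopologicalSpace M] [ChartedSpace H M] [IsManifold I ∞ M]
  [RiemannianBundle (fun x : M ↦ TangentSpace I x)] {n s : ℕ}
  (S : WeakMetricFStructure I M n s) {x : M} {v : TangentSpace I x}

theorem f_ξ (x : M) (i : Fin s) : S.f x (S.ξ i x) = 0 := by
  have f_f_ξ : S.f x (S.f x (S.ξ i x)) = 0 := by simp [S.f_sq, S.Q_ξ, S.η_ξ]
  rw [← inner_self_eq_zero (𝕜 := ℝ), S.f_skew, f_f_ξ, inner_zero_right, neg_zero]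

theorem η_eq_inner_ξ (x : M) (v : TangentSpace I x) (i : Fin s) :
    S.η i x v = inner ℝ v (S.ξ i x) := by
  have h := S.inner_f_f x v (S.ξ i x)
  simp only [S.f_ξ, inner_zero_right, S.Q_ξ, S.η_ξ, mul_ite, mul_one, mul_zero,
    Finset.sum_ite_eq', Finset.mem_univ, if_true] at h
  linarith

theorem mem_contactDistribution : v ∈ S.contactDistribution x ↔ ∀ i, S.η i x v = 0 := by
  simp [contactDistribution]

theorem f_f_of_mem_contactDistribution (hQ : S.Q x = ContinuousLinearMap.id ℝ _)
    (hv : v ∈ S.contactDistribution x) : S.f x (S.f x v) = -v := by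
  simp [S.f_sq, hQ, S.mem_contactDistribution.1 hv]

end WeakMetricFStructure

end FManifold

open FManifold in
theorem mainTheorem8_general {E : Type*} [NormedAddCommGroup E] [NormedSpace ℝ E]
    [FiniteDimensional ℝ E] {H : Type*} [TopologicalSpace H] {I : ModelWithCorners ℝ E H}
    {M : Type*} [TopologicalSpace M] [ChartedSpace H M] [IsManifold I ∞ M]
    [RiemannianBundle (fun x : M ↦ TangentSpace I x)]
    [IsContMDiffRiemannianBundle I ∞ E (fun x : M ↦ TangentSpace I x)]
    {cov : CovariantDerivative I E (fun x : M ↦ TangentSpace I x)} (hcov : IsLeviCivita cov)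
    {f : Π x : M, TangentSpace I x →L[ℝ] TangentSpace I x} (f_smooth : IsSmoothEndo f)
    (f_skew : IsSkewSymmetric f) (f_nearlyParallel : IsNearlyParallel cov f)
    {X Y Z ξ : Π x : M, TangentSpace I x} (hX : IsSmoothField X) (hY : IsSmoothField Y)
    (hZ : IsSmoothField Z) (hξ : IsSmoothField ξ) {p : M} (hXp : f p (f p (X p)) = -X p)
    (hYp : f p (f p (Y p)) = -Y p) (hZp : f p (f p (Z p)) = -Z p) (hξp : f p (ξ p) = 0) :
    inner ℝ (curvature cov X Y Z p) (ξ p) = 0 := by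
  have := FiniteDimensional.complete ℝ E
  have := hcov.smooth
  have torsionFree : IsTorsionFree cov := hcov.torsion_free
  let V := {X : SmoothField I M // f p (f p (X.1 p)) = -X.1 p}
  let J (X : V) : V := ⟨X.1.map f_smooth, by simp only [SmoothField.map, X.2, map_neg]⟩
  have sq_smooth (X : V) : IsSmoothField (J (J X)).1.1 := (J (J X)).1.2
  refine eq_zero_of_derivation_eq_zero_of_sq_eq_neg J
    (fun X Y Z ↦ curvatureForm cov p X.1 Y.1 Z.1 ⟨ξ, hξ⟩)
    (fun X Y Z ↦ ?_) (fun X Y Z ↦ ?_) (fun X Y Z ↦ ?_) (fun X Y Z ↦ ?_)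
    ⟨⟨X, hX⟩, hXp⟩ ⟨⟨Y, hY⟩, hYp⟩ ⟨⟨Z, hZ⟩, hZp⟩
  · rw [curvatureForm, curvature_eq_neg_of_left_eq_neg X.1.2 (sq_smooth X) Z.1.2 X.2,
      inner_neg_left, curvatureForm]
  · rw [curvatureForm, curvature_eq_neg_of_middle_eq_neg Y.1.2 (sq_smooth Y) Z.1.2 Y.2,
      inner_neg_left, curvatureForm]
  · rw [curvatureForm, torsionFree.curvature_eq_neg_of_right_eq_neg X.1.2 Y.1.2 Z.1.2
      (sq_smooth Z) Z.2, inner_neg_left, curvatureForm]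
  · have h := f_nearlyParallel.derivAction_curvatureForm_eq_zero hcov f_smooth f_skew p
      X.1 Y.1 Z.1 ⟨ξ, hξ⟩
    have last : curvatureForm cov p X.1 Y.1 Z.1 (SmoothField.map f_smooth ⟨ξ, hξ⟩) = 0 := by
      simp only [curvatureForm, SmoothField.map, hξp, inner_zero_right]
    rwa [derivAction, last, add_zero] at h

theorem mainTheorem8 {E : Type*} [NormedAddCommGroup E] [NormedSpace ℝ E] [FiniteDimensional ℝ E]
    {M : Type*} [TopologicalSpace M] [T2Space M] [SecondCountableTopology M]
    [ChartedSpace E M] [IsManifold 𝓘(ℝ, E) ∞ M]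
    [RiemannianBundle (fun x : M ↦ TangentSpace 𝓘(ℝ, E) x)]
    [IsContMDiffRiemannianBundle 𝓘(ℝ, E) ∞ E (fun x : M ↦ TangentSpace 𝓘(ℝ, E) x)]
    (cov : CovariantDerivative 𝓘(ℝ, E) E (fun x : M ↦ TangentSpace 𝓘(ℝ, E) x))
    (hcov : FManifold.IsLeviCivita cov)
    {n s : ℕ} (S : FManifold.WeakMetricFStructure 𝓘(ℝ, E) M n s) (hS : S.IsNearlyC cov)
    (X Y Z : Π x : M, TangentSpace 𝓘(ℝ, E) x)
    (hX : FManifold.IsSmoothField X) (hY : FManifold.IsSmoothField Y)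
    (hZ : FManifold.IsSmoothField Z) (p : M)
    (hXp : X p ∈ S.contactDistribution p) (hYp : Y p ∈ S.contactDistribution p)
    (hZp : Z p ∈ S.contactDistribution p) :
    FManifold.curvature cov X Y Z p ∈ S.contactDistribution p := by
  have f_f {V : Π x : M, TangentSpace 𝓘(ℝ, E) x} (hV : V p ∈ S.contactDistribution p) :
      S.f p (S.f p (V p)) = -V p :=
    S.f_f_of_mem_contactDistribution (hS.2 p) hV
  refine S.mem_contactDistribution.2 fun i ↦ ?_
  rw [S.η_eq_inner_ξ]
  exact mainTheorem8_general hcov S.f_smooth S.f_skew hS.1 hX hY hZ (S.ξ_smooth i) (f_f hXp)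
    (f_f hYp) (f_f hZp) (S.f_ξ p i)
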